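/- The Tower of Hanoi with $n\ge 0$ disks of distinct sizes and three pegs $1,2,3$ has $3^n$ states (an assignment of a peg to each disk; on each peg the disks are ordered by size, the smallest on top). A valid move takes the top disk of a peg and puts it on another peg on which there is no smaller disk. A random move is a move chosen uniformly from the set of valid moves in the current state, independently of the past. (For $n=0$ there is a single state, and all the expected numbers below are $0$.) Let $E_{r\to 1}(n)$ be the expected number of random moves until all disks lie on peg $1$, when the starting state is chosen uniformly from all $3^n$ states; let $E_{r\to a}(n)$ be the expected number of random moves until all disks lie on the same (any) peg, from a uniformly random starting state; and let $E_{1\to 3}(n)$ be the expected number of random moves until all disks lie on peg $3$, starting with all disks on peg $1$. (No move is needed if the starting state is already final.) Then $E_{r\to 1}(n)$ is finite and $$E_{r\to 1}(n)=\frac{5^{n+1}-2\cdot 3^{n+1}+5}{4}-\left(\frac53\right)^n=\frac{(3^n-1)(5^{n+1}-2\cdot 3^{n+1})+5^n-3^n}{4\cdot 3^n}.$$ Moreover, $$E_{r\to 1}(n)=E_{r\to a}(n)+\tfrac23\,E_{1\to 3}(n).$$ -/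

import Mathlib

open MeasureTheory ProbabilityTheory
open scoped ENNReal

namespace Hanoi

/-- A state of the Tower of Hanoi with `n` disks: `s d` is the peg of disk `d`.
Disks are indexed by increasing size, so disk `0` is the smallest one; the pegs `1, 2, 3` are
`0, 1, 2 : Fin 3`.  The order of the disks on a peg is forced by their sizes. -/
abbrev State (n : ℕ) : Type := Fin n → Fin 3

/-- Moving disk `d` is a valid move from `s` to `t`: the disk `d` changes its peg, all other disks
stay, and no smaller disk lies on the peg that `d` leaves (so `d` is on top there) or on the
peg that `d` goes to. -/
def IsMove {n : ℕ} (s t : State n) (d : Fin n) : Prop :=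
  s d ≠ t d ∧ (∀ e, e ≠ d → s e = t e) ∧ ∀ e, e < d → s e ≠ s d ∧ s e ≠ t d

instance {n : ℕ} (s t : State n) (d : Fin n) : Decidable (IsMove s t d) := by
  unfold IsMove
  infer_instance

/-- The state transition diagram: two states are adjacent when one valid move leads from one to
the other. -/
def graph (n : ℕ) : SimpleGraph (State n) where
  Adj s t := ∃ d, IsMove s t d
  symm := ⟨by
    rintro s t ⟨d, hd, ho, hs⟩
    refine ⟨d, hd.symm, fun e he => (ho e he).symm, fun e he => ?_⟩
    rw [← ho e he.ne]
    exact ⟨(hs e he).2, (hs e he).1⟩⟩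
  loopless := ⟨by
    rintro s ⟨d, hd, -⟩
    exact hd rfl⟩

instance (n : ℕ) : DecidableRel (graph n).Adj := fun s t =>
  inferInstanceAs (Decidable (∃ d, IsMove s t d))

/-- The law of the state after one random move from `s`: uniform on the states that can be reached
by a valid move.  With at least one disk there always is a valid move; with no disk there is none,
and the only state is kept. -/
noncomputable def stepPMF {n : ℕ} (s : State n) : PMF (State n) :=
  if h : ((graph n).neighborFinset s).Nonempty then
    PMF.uniformOfFinset ((graph n).neighborFinset s) h
  else PMF.pure s

/-- The transition kernel of the random walk. -/
noncomputable def stepKernel (n : ℕ) : Kernel (State n) (State n) :=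
  Kernel.ofFunOfCountable fun s => (stepPMF s).toMeasure

instance (n : ℕ) : IsMarkovKernel (stepKernel n) :=
  ⟨fun s => inferInstanceAs (IsProbabilityMeasure (stepPMF s).toMeasure)⟩

/-- The law, on the space of infinite sequences of states, of the sequence of states visited by
random moves when the starting state is distributed according to `start`. -/
noncomputable def walkLaw {n : ℕ} (start : PMF (State n)) : Measure (ℕ → State n) :=
  Kernel.trajMeasure (X := fun _ => State n) start.toMeasure fun k =>
    (stepKernel n).comap (fun x : (Π _ : Finset.Iic k, State n) => x ⟨k, Finset.mem_Iic.2 le_rfl⟩)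
      (measurable_pi_apply _)

/-- The number of moves made until the sequence of states `ω` first is in `A`
(`∞` if that never happens, `0` if it starts in `A`). -/
noncomputable def hitTime {n : ℕ} (A : Set (State n)) (ω : ℕ → State n) : ℝ≥0∞ :=
  ⨅ (k : ℕ) (_ : ω k ∈ A), (k : ℝ≥0∞)

/-- The expected number of random moves, from a starting state distributed according to `start`,
until the state is in `A`. -/
noncomputable def expectedMoves {n : ℕ} (start : PMF (State n)) (A : Set (State n)) : ℝ≥0∞ :=
  ∫⁻ ω, hitTime A ω ∂(walkLaw start)

/-- The state with all disks on peg `p`. -/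
def allOn (n : ℕ) (p : Fin 3) : State n := fun _ => p

/-- `E_{r→1}(n)`: random starting state, all disks have to reach the first peg. -/
noncomputable def ErandomToFirst (n : ℕ) : ℝ≥0∞ :=
  expectedMoves (PMF.uniformOfFintype (State n)) {allOn n 0}

/-- `E_{r→a}(n)`: random starting state, all disks have to be on the same peg. -/
noncomputable def ErandomToAny (n : ℕ) : ℝ≥0∞ :=
  expectedMoves (PMF.uniformOfFintype (State n)) (Set.range (allOn n))

/-- `E_{1→3}(n)`: all disks start on the first peg and have to reach the third peg. -/
noncomputable def EfirstToThird (n : ℕ) : ℝ≥0∞ :=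
  expectedMoves (PMF.pure (allOn n 0)) {allOn n 2}

end Hanoi

namespace Hanoi

/-! Expected hitting times solve the first step equations, and conversely any real solution of them
on the finite state space is the expected hitting time (`hasSum_survival`, `expectedMoves_eq`). It
therefore suffices to exhibit solutions. Multiplied by the degree, the equations say that the
Laplacian equals the degree: `3` away from the corners and, for `n ≥ 1`, `2` at the corners. The
graph for `n + 1` disks is three copies of the graph for `n`, joined pairwise by one edge, so an
electrical star-triangle recursion builds `potential n c φ`, whose corner values are `c +
starResistance n * φ i` (`potential_allOn`) and whose mean is `c` plus a term free of `φ`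
(`sum_potential`). Zero flux with `c = 0` vanishes at all corners and gives `E_{r→a}`. Flux `3 ^ n -
1` at two corners, with `c` chosen to vanish at the third, gives `E_{r→1}` and `E_{1→3}`. The two
means differ by `c = 2R(3^n - 1)`, where `R` is the star resistance, and `E_{1→3} = 3R(3^n - 1)`;
hence the factor `2/3`. -/

/-! ### Hitting times and the killed walk -/

theorem walkLaw_map_zero {n : ℕ} (start : PMF (State n)) :
    (walkLaw start).map (fun ω => ω 0) = start.toMeasure := by
  have h : (fun ω : ℕ → State n => ω 0) =
      (fun x : (Π _ : Finset.Iic 0, State n) => x ⟨0, Finset.mem_Iic.2 le_rfl⟩) ∘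
        Preorder.frestrictLe 0 := rfl
  rw [h, ← Measure.map_map (by fun_prop) (by fun_prop), walkLaw, Kernel.trajMeasure,
    Measure.map_comp _ _ (by fun_prop), Kernel.traj_map_frestrictLe, Kernel.partialTraj_self,
    Measure.id_comp, Measure.map_map (by fun_prop) (by fun_prop)]
  exact Measure.map_id

/-- The Markov property, tested on products of a function of the past and a function of the next
state. -/
theorem lintegral_walkLaw_succ {n : ℕ} (start : PMF (State n)) (k : ℕ)
    (F : (Π _ : Finset.Iic k, State n) → ℝ≥0∞) (f : State n → ℝ≥0∞) :
    ∫⁻ ω, F (Preorder.frestrictLe k ω) * f (ω (k + 1)) ∂walkLaw start =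
      ∫⁻ ω, F (Preorder.frestrictLe k ω) * ∫⁻ t, f t ∂stepKernel n (ω k) ∂walkLaw start := by
  have hF : Measurable F := measurable_of_countable F
  have hf : Measurable f := measurable_of_countable f
  have key := Kernel.map_frestrictLe_trajMeasure_compProd_eq_map_trajMeasure
    (X := fun _ => State n) (μ₀ := start.toMeasure)
    (κ := fun k => (stepKernel n).comap
      (fun x : (Π _ : Finset.Iic k, State n) => x ⟨k, Finset.mem_Iic.2 le_rfl⟩)
      (measurable_pi_apply _)) (a := k)
  have h := congrArg (fun μ => ∫⁻ z, F z.1 * f z.2 ∂μ) key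
  rw [Measure.lintegral_compProd (by fun_prop), lintegral_map (by fun_prop) (by fun_prop),
    lintegral_map (by fun_prop) (by fun_prop)] at h
  rw [walkLaw, ← h]
  refine lintegral_congr fun ω => ?_
  exact lintegral_const_mul (μ := stepKernel n (ω k)) (F (Preorder.frestrictLe k ω)) hf

/-- One step of the walk that is killed in `A`, acting on functions. -/
noncomputable def killedStep {n : ℕ} (A : Set (State n)) (f : State n → ℝ) : State n → ℝ :=
  Aᶜ.indicator fun s => ∑ t, (stepPMF s t).toReal * f t

/-- The probability that the first `k` moves of the walk from `s` do not lead into `A` (and that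
`s` does not lie in `A`). -/
noncomputable def survival {n : ℕ} (A : Set (State n)) (k : ℕ) : State n → ℝ :=
  (killedStep A)^[k] (Aᶜ.indicator 1)

theorem killedStep_nonneg {n : ℕ} (A : Set (State n)) {f : State n → ℝ} (hf : 0 ≤ f) :
    0 ≤ killedStep A f := fun _ => Set.indicator_nonneg
  (fun _ _ => Finset.sum_nonneg fun t _ => mul_nonneg ENNReal.toReal_nonneg (hf t)) _

theorem indicator_lintegral_stepKernel {n : ℕ} (A : Set (State n)) {f : State n → ℝ} (hf : 0 ≤ f)
    (s : State n) : Aᶜ.indicator (fun s => ∫⁻ t, ENNReal.ofReal (f t) ∂stepKernel n s) s =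
      ENNReal.ofReal (killedStep A f s) := by
  by_cases hs : s ∈ Aᶜ
  · rw [killedStep, Set.indicator_of_mem hs, Set.indicator_of_mem hs,
      ENNReal.ofReal_sum_of_nonneg fun t _ => mul_nonneg ENNReal.toReal_nonneg (hf t)]
    rw [lintegral_fintype]
    refine Finset.sum_congr rfl fun t _ => ?_
    rw [ENNReal.ofReal_mul ENNReal.toReal_nonneg, ENNReal.ofReal_toReal ((stepPMF s).apply_ne_top t),
      mul_comm]
    congr 1
    exact PMF.toMeasure_apply_singleton _ _ (measurableSet_singleton t)
  · simp [killedStep, Set.indicator_of_notMem hs]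

/-- The indicator of the event that the walk does not visit `A` up to time `k`. -/
noncomputable def avoids {n : ℕ} (A : Set (State n)) (k : ℕ) (ω : ℕ → State n) : ℝ≥0∞ :=
  ∏ j ∈ Finset.range (k + 1), Aᶜ.indicator 1 (ω j)

theorem measurable_avoids {n : ℕ} (A : Set (State n)) (k : ℕ) : Measurable (avoids A k) :=
  Finset.measurable_prod _ fun j _ =>
    (measurable_of_countable (Aᶜ.indicator 1 : State n → ℝ≥0∞)).comp (measurable_pi_apply j)

/-- Integrating out the last step replaces `f` by `killedStep A (Aᶜ.indicator f)`, so the induction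
on `k` has to vary `f`. -/
theorem lintegral_avoids_mul {n : ℕ} (start : PMF (State n)) (A : Set (State n)) (k : ℕ)
    {f : State n → ℝ} (hf : 0 ≤ f) :
    ∫⁻ ω, avoids A k ω * ENNReal.ofReal (f (ω k)) ∂walkLaw start =
      ∑ s, start s * ENNReal.ofReal ((killedStep A)^[k] (Aᶜ.indicator f) s) := by
  induction k generalizing f with
  | zero =>
    have h : ∀ ω : ℕ → State n, avoids A 0 ω * ENNReal.ofReal (f (ω 0)) =
        (fun s => ENNReal.ofReal (Aᶜ.indicator f s)) (ω 0) := by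
      intro ω
      by_cases hs : ω 0 ∈ A <;> simp [avoids, hs]
    simp_rw [h]
    rw [← lintegral_map (f := fun s => ENNReal.ofReal (Aᶜ.indicator f s))
      (g := fun ω : ℕ → State n => ω 0) (measurable_of_countable _) (by fun_prop),
      walkLaw_map_zero, lintegral_fintype]
    refine Finset.sum_congr rfl fun s _ => ?_
    rw [PMF.toMeasure_apply_singleton _ _ (measurableSet_singleton s), mul_comm]
    rfl
  | succ k ih =>
    have hf' : 0 ≤ Aᶜ.indicator f := Set.indicator_nonneg fun s _ => hf s
    have h1 : ∀ ω : ℕ → State n, avoids A (k + 1) ω * ENNReal.ofReal (f (ω (k + 1))) =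
        avoids A k ω * ENNReal.ofReal (Aᶜ.indicator f (ω (k + 1))) := by
      intro ω
      rw [avoids, Finset.prod_range_succ, ← avoids]
      by_cases hs : ω (k + 1) ∈ A <;> simp [hs]
    have h2 : ∀ ω : ℕ → State n,
        avoids A k ω * ∫⁻ t, ENNReal.ofReal (Aᶜ.indicator f t) ∂stepKernel n (ω k) =
          avoids A k ω * ENNReal.ofReal (killedStep A (Aᶜ.indicator f) (ω k)) := by
      intro ω
      rw [← indicator_lintegral_stepKernel A hf', avoids, Finset.prod_range_succ]
      by_cases hs : ω k ∈ A <;> simp [hs]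
    have h3 : ∀ ω : ℕ → State n, avoids A k ω =
        (fun x : (Π _ : Finset.Iic k, State n) => ∏ j ∈ (Finset.range (k + 1)).attach,
          Aᶜ.indicator (1 : State n → ℝ≥0∞) (x ⟨j, Finset.mem_Iic.2 (Finset.mem_range_succ_iff.1 j.2)⟩))
          (Preorder.frestrictLe k ω) := by
      intro ω
      exact (Finset.prod_attach _ fun j => Aᶜ.indicator (1 : State n → ℝ≥0∞) (ω j)).symm
    have h4 := lintegral_walkLaw_succ start k (fun x : (Π _ : Finset.Iic k, State n) =>
        ∏ j ∈ (Finset.range (k + 1)).attach, Aᶜ.indicator (1 : State n → ℝ≥0∞)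
          (x ⟨j, Finset.mem_Iic.2 (Finset.mem_range_succ_iff.1 j.2)⟩))
      fun t => ENNReal.ofReal (Aᶜ.indicator f t)
    simp only [← h3] at h4
    have h5 : Aᶜ.indicator (killedStep A (Aᶜ.indicator f)) = killedStep A (Aᶜ.indicator f) := by
      simp [killedStep]
    simp_rw [h1]
    rw [h4]
    simp_rw [h2]
    rw [ih (killedStep_nonneg A hf'), h5, Function.iterate_succ_apply]

theorem lintegral_avoids {n : ℕ} (start : PMF (State n)) (A : Set (State n)) (k : ℕ) :
    ∫⁻ ω, avoids A k ω ∂walkLaw start = ∑ s, start s * ENNReal.ofReal (survival A k s) := by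
  simpa [survival] using lintegral_avoids_mul start A k (f := 1) zero_le_one

/-- The summand is `1` exactly for `k` below the hitting time, also when that is infinite. -/
theorem hitTime_eq_tsum {n : ℕ} (A : Set (State n)) (ω : ℕ → State n) :
    hitTime A ω = ∑' k, avoids A k ω := by
  classical
  by_cases h : ∃ k, ω k ∈ A
  · have h1 : ∀ k < Nat.find h, avoids A k ω = 1 := fun k hk =>
      Finset.prod_eq_one fun j hj => by
        have : ω j ∉ A := Nat.find_min h ((Finset.mem_range_succ_iff.1 hj).trans_lt hk)
        simp [this]
    have h2 : ∀ k ∉ Finset.range (Nat.find h), avoids A k ω = 0 := fun k hk =>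
      Finset.prod_eq_zero (i := Nat.find h)
        (Finset.mem_range_succ_iff.2 (by simpa using hk)) (by simp [Nat.find_spec h])
    rw [tsum_eq_sum h2, Finset.sum_congr rfl fun k hk => h1 k (Finset.mem_range.1 hk)]
    simp only [Finset.sum_const, Finset.card_range, nsmul_eq_mul, mul_one]
    refine le_antisymm (iInf₂_le (Nat.find h) (Nat.find_spec h)) (le_iInf₂ fun k hk => ?_)
    exact_mod_cast Nat.find_min' h hk
  · push Not at h
    have h1 : ∀ k, avoids A k ω = 1 := fun k => Finset.prod_eq_one fun j _ => by simp [h j]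
    simp [hitTime, h, h1]

theorem survival_nonneg {n : ℕ} (A : Set (State n)) (k : ℕ) : 0 ≤ survival A k := by
  induction k with
  | zero => exact Set.indicator_nonneg fun _ _ => zero_le_one
  | succ k ih =>
    rw [survival, Function.iterate_succ_apply']
    exact killedStep_nonneg A ih

theorem killedStep_sum {n : ℕ} (A : Set (State n)) (N : ℕ) (s : State n) :
    killedStep A (fun t => ∑ k ∈ Finset.range N, survival A k t) s =
      ∑ k ∈ Finset.range N, survival A (k + 1) s := by
  have h : ∀ k, survival A (k + 1) s = killedStep A (survival A k) s := fun k => by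
    rw [survival, Function.iterate_succ_apply', ← survival]
  simp only [h]
  by_cases hs : s ∈ Aᶜ
  · simp only [killedStep, Set.indicator_of_mem hs, Finset.mul_sum]
    exact Finset.sum_comm
  · simp [killedStep, Set.indicator_of_notMem hs]

/-! ### Solutions of the first step equations -/

/-- No connectivity of the graph is needed: the existence of a bounded solution already forces the
survival probabilities to be summable. -/
theorem hasSum_survival {n : ℕ} {A : Set (State n)} {g : State n → ℝ} (hA : ∀ s ∈ A, g s = 0)
    (hg : ∀ s ∉ A, g s = 1 + ∑ t, (stepPMF s t).toReal * g t) (s : State n) :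
    HasSum (fun k => survival A k s) (g s) := by
  obtain ⟨M, hM⟩ : ∃ M, ∀ s, |g s| ≤ M :=
    ⟨∑ s, |g s|, fun s => Finset.single_le_sum (f := fun s => |g s|) (fun _ _ => abs_nonneg _)
      (Finset.mem_univ s)⟩
  have hM0 : 0 ≤ M := (abs_nonneg _).trans (hM s)
  -- The error evolves under `killedStep` alone, since the source term `1` cancels `survival A 0`.
  have herr : ∀ N s, |g s - ∑ k ∈ Finset.range N, survival A k s| ≤ M * survival A N s := by
    intro N
    induction N with
    | zero =>
      intro s
      by_cases hs : s ∈ A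
      · simp [survival, hs, hA s hs]
      · simpa [survival, hs] using hM s
    | succ N ih =>
      intro s
      rw [Finset.sum_range_succ', ← killedStep_sum]
      have h0 : survival A (N + 1) s = killedStep A (survival A N) s := by
        rw [survival, Function.iterate_succ_apply', ← survival]
      rw [h0]
      by_cases hs : s ∈ A
      · simp [survival, killedStep, hs, hA s hs]
      · have h1 : survival A 0 s = 1 := by simp [survival, hs]
        have hs' : s ∈ Aᶜ := hs
        rw [h1, hg s hs, killedStep, killedStep, Set.indicator_of_mem hs',
          Set.indicator_of_mem hs']
        calc _ = |∑ t, (stepPMF s t).toReal * (g t - ∑ k ∈ Finset.range N, survival A k t)| := by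
              simp only [mul_sub, Finset.sum_sub_distrib]
              congr 1
              ring
          _ ≤ ∑ t, (stepPMF s t).toReal * (M * survival A N t) := by
              refine (Finset.abs_sum_le_sum_abs _ _).trans (Finset.sum_le_sum fun t _ => ?_)
              rw [abs_mul, abs_of_nonneg ENNReal.toReal_nonneg]
              exact mul_le_mul_of_nonneg_left (ih t) ENNReal.toReal_nonneg
          _ = _ := by
              rw [Finset.mul_sum]
              exact Finset.sum_congr rfl fun t _ => by ring
  have hle : ∀ k s, survival A k s ≤ 1 := by
    intro k
    induction k with
    | zero => exact fun s => Set.indicator_le' (fun _ _ => le_rfl) (fun _ _ => zero_le_one) s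
    | succ k ih =>
      intro s
      rw [survival, Function.iterate_succ_apply', ← survival]
      refine Set.indicator_le' (f := fun s => ∑ t, (stepPMF s t).toReal * survival A k t)
        (g := fun _ => (1 : ℝ)) (fun s _ => ?_) (fun _ _ => zero_le_one) s
      calc _ ≤ ∑ t, (stepPMF s t).toReal := Finset.sum_le_sum fun t _ =>
            mul_le_of_le_one_right ENNReal.toReal_nonneg (ih t)
        _ = 1 := by
            rw [← ENNReal.toReal_sum fun t _ => (stepPMF s).apply_ne_top t, ← tsum_fintype (L := .unconditional _),
              PMF.tsum_coe, ENNReal.toReal_one]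
  have hsummable : Summable fun k => survival A k s := by
    -- One `M` bounds `g s`, the other bounds the error because survival is at most `1`. Summability
    -- then sends survival, and with it the error, to `0`.
    refine summable_of_sum_range_le (c := 2 * M) (fun k => survival_nonneg A k s) fun N => ?_
    have h1 := (abs_le.1 (herr N s)).1
    have h2 := (abs_le.1 (hM s)).2
    have h3 := mul_le_mul_of_nonneg_left (hle N s) hM0
    linarith
  refine hsummable.hasSum_iff_tendsto_nat.2 ?_
  have h0 := hsummable.tendsto_atTop_zero.const_mul M
  rw [mul_zero] at h0
  have := squeeze_zero_norm (f := fun N => g s - ∑ k ∈ Finset.range N, survival A k s)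
    (fun N => herr N s) h0
  simpa using (tendsto_const_nhds (x := g s)).sub this

/-- A solution of the first step equations gives the expected number of moves. -/
theorem expectedMoves_eq {n : ℕ} (start : PMF (State n)) {A : Set (State n)} {g : State n → ℝ}
    (hA : ∀ s ∈ A, g s = 0) (hg : ∀ s ∉ A, g s = 1 + ∑ t, (stepPMF s t).toReal * g t) :
    expectedMoves start A = ∑ s, start s * ENNReal.ofReal (g s) := by
  have h : ∀ s, ENNReal.ofReal (g s) = ∑' k, ENNReal.ofReal (survival A k s) := fun s => by
    rw [← (hasSum_survival hA hg s).tsum_eq]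
    exact ENNReal.ofReal_tsum_of_nonneg (fun k => survival_nonneg A k s)
      (hasSum_survival hA hg s).summable
  rw [expectedMoves]
  simp_rw [hitTime_eq_tsum]
  rw [lintegral_tsum fun k => (measurable_avoids A k).aemeasurable]
  simp_rw [lintegral_avoids, h, ← ENNReal.tsum_mul_left]
  exact Summable.tsum_finsetSum fun _ _ => ENNReal.summable

theorem nonneg_of_first_step {n : ℕ} {A : Set (State n)} {g : State n → ℝ}
    (hA : ∀ s ∈ A, g s = 0) (hg : ∀ s ∉ A, g s = 1 + ∑ t, (stepPMF s t).toReal * g t)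
    (s : State n) : 0 ≤ g s :=
  (hasSum_survival hA hg s).nonneg fun k => survival_nonneg A k s

/-! ### Recursive structure of the graph -/

/-- The pegs sum to `0` in `Fin 3`, so for `p ≠ q` the third peg is `-(p + q)`; all smaller disks
must be there when the largest one moves. -/
theorem adj_snoc_iff {n : ℕ} (s t : State n) (p q : Fin 3) :
    (graph (n + 1)).Adj (Fin.snoc s p) (Fin.snoc t q) ↔
      p = q ∧ (graph n).Adj s t ∨ p ≠ q ∧ s = t ∧ s = allOn n (-(p + q)) := by
  have third : ∀ a p q : Fin 3, p ≠ q → (a ≠ p ∧ a ≠ q ↔ a = -(p + q)) := by decide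
  constructor
  · rintro ⟨d, h1, h2, h3⟩
    induction d using Fin.lastCases with
    | last =>
      simp only [Fin.snoc_last] at h1 h3
      refine Or.inr ⟨h1, funext fun e => ?_, funext fun e => ?_⟩
      · simpa using h2 e.castSucc (Fin.castSucc_ne_last e)
      · have := h3 e.castSucc (Fin.castSucc_lt_last e)
        simp only [Fin.snoc_castSucc] at this
        exact (third _ _ _ h1).1 this
    | cast d =>
      simp only [Fin.snoc_castSucc] at h1 h3
      refine Or.inl ⟨by simpa using h2 (Fin.last n) (Fin.castSucc_ne_last d).symm, d, h1,
        fun e he => ?_, fun e he => ?_⟩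
      · simpa using h2 e.castSucc (by simpa using he)
      · simpa using h3 e.castSucc (by simpa using he)
  · rintro (⟨rfl, d, h1, h2, h3⟩ | ⟨hpq, rfl, hs⟩)
    · refine ⟨d.castSucc, by simpa using h1, fun e he => ?_, fun e he => ?_⟩
      · induction e using Fin.lastCases with
        | last => simp
        | cast e => simpa using h2 e (by simpa using he)
      · induction e using Fin.lastCases with
        | last => exact absurd he (Fin.castSucc_lt_last d).not_gt
        | cast e => simpa using h3 e (by simpa using he)
    · refine ⟨Fin.last n, by simpa using hpq, fun e he => ?_, fun e he => ?_⟩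
      · induction e using Fin.lastCases with
        | last => exact absurd rfl he
        | cast e => simp
      · induction e using Fin.lastCases with
        | last => exact absurd he (lt_irrefl _)
        | cast e =>
          simp only [Fin.snoc_castSucc, Fin.snoc_last]
          exact (third _ _ _ hpq).2 (congrFun hs e)

theorem sum_state_succ {M : Type*} [AddCommMonoid M] (n : ℕ) (f : State (n + 1) → M) :
    ∑ t, f t = ∑ q, ∑ t : State n, f (Fin.snoc t q) := by
  rw [← Fintype.sum_prod_type']
  exact (Fintype.sum_equiv (Fin.snocEquiv fun _ => Fin 3) _ _ fun _ => rfl).symm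

/-- The neighbours of a state with `n + 1` disks: either the largest disk stays, or all the others
are together on a peg `q` and the largest disk moves between the two other pegs. -/
theorem sum_neighborFinset_snoc {n : ℕ} (s : State n) (p : Fin 3) (f : State (n + 1) → ℝ) :
    ∑ t ∈ (graph (n + 1)).neighborFinset (Fin.snoc s p), f t =
      ∑ t ∈ (graph n).neighborFinset s, f (Fin.snoc t p) +
        ∑ q, if q ≠ p ∧ s = allOn n q then f (Fin.snoc s (-(p + q))) else 0 := by
  have key : ∀ q : Fin 3, (∑ t : State n,
      if (graph (n + 1)).Adj (Fin.snoc s p) (Fin.snoc t q) then f (Fin.snoc t q) else 0) =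
      (if p = q then ∑ t, if (graph n).Adj s t then f (Fin.snoc t p) else 0 else 0) +
        if p ≠ q ∧ s = allOn n (-(p + q)) then f (Fin.snoc s q) else 0 := by
    intro q
    simp only [adj_snoc_iff]
    by_cases h : p = q
    · subst h
      simp
    · by_cases h' : s = allOn n (-(p + q))
      · simp only [h, false_and, ne_eq, not_false_eq_true, true_and, false_or, h', and_true, if_true,
          if_false, zero_add]
        simp
      · simp only [h, false_and, ne_eq, not_false_eq_true, false_or, h', and_false, if_false,
          zero_add, Finset.sum_const_zero]
  have hnb : ∀ (m : ℕ) (x : State m) (g : State m → ℝ),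
      ∑ t ∈ (graph m).neighborFinset x, g t = ∑ t, if (graph m).Adj x t then g t else 0 := by
    intro m x g
    rw [← Finset.sum_filter]
    refine Finset.sum_congr ?_ fun _ _ => rfl
    ext t
    simp
  rw [hnb, hnb, sum_state_succ, Finset.sum_congr rfl fun q _ => key q, Finset.sum_add_distrib,
    Finset.sum_ite_eq, if_pos (Finset.mem_univ _)]
  congr 1
  -- This involution fixes `p` and swaps the two other pegs, exchanging the destination of the
  -- largest disk with the peg of the rest.
  refine Finset.sum_nbij' (fun q => -(p + q)) (fun q => -(p + q)) (by simp) (by simp)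
    (fun q _ => by abel) (fun q _ => by abel) fun q _ => ?_
  have h1 : -(p + -(p + q)) = q := by abel
  have h2 : p ≠ q ↔ -(p + q) ≠ p := by clear h1 key; revert p q; decide
  simp only [h1, h2]

/-- The combinatorial Laplacian of the state transition diagram. -/
def laplacian {n : ℕ} (f : State n → ℝ) (s : State n) : ℝ :=
  ∑ t ∈ (graph n).neighborFinset s, (f s - f t)

theorem laplacian_snoc {n : ℕ} (f : State (n + 1) → ℝ) (s : State n) (p : Fin 3) :
    laplacian f (Fin.snoc s p) = laplacian (fun t => f (Fin.snoc t p)) s +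
      ∑ q, if q ≠ p ∧ s = allOn n q then
        f (Fin.snoc s p) - f (Fin.snoc s (-(p + q))) else 0 :=
  sum_neighborFinset_snoc s p fun t => f (Fin.snoc s p) - f t

theorem snoc_eq_allOn_iff {n : ℕ} (s : State n) (p i : Fin 3) :
    (Fin.snoc s p : State (n + 1)) = allOn (n + 1) i ↔ p = i ∧ s = allOn n i := by
  constructor
  · intro h
    refine ⟨by simpa [allOn] using congrFun h (Fin.last n), funext fun e => ?_⟩
    simpa [allOn] using congrFun h e.castSucc
  · rintro ⟨rfl, rfl⟩
    funext e
    induction e using Fin.lastCases with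
    | last => simp [allOn]
    | cast e => simp [allOn]

theorem degree_eq (n : ℕ) (s : State n) :
    (((graph n).neighborFinset s).card : ℝ) = 3 - ∑ i, if s = allOn n i then 1 else 0 := by
  induction n with
  | zero =>
    have h1 : ∀ i (x : ℝ), (if s = allOn 0 i then x else 0) = x := fun i _ =>
      if_pos (Subsingleton.elim _ _)
    simp [h1]
  | succ n ih =>
    rw [← Fin.snoc_init_self s]
    generalize Fin.init s = s', s (Fin.last n) = p
    have h := sum_neighborFinset_snoc s' p fun _ => (1 : ℝ)
    simp only [Finset.sum_const, nsmul_eq_mul, mul_one] at h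
    rw [h, ih s']
    simp only [snoc_eq_allOn_iff, Fin.sum_univ_three]
    fin_cases p <;> simp <;> ring

/-! ### The potential and its equivalent star -/

/-- The effective resistance from a corner to the centre of the star that is equivalent to the
state transition diagram between its three corners. -/
noncomputable def starResistance (n : ℕ) : ℝ := ((5 / 3) ^ n - 1) / 2

/-- A function with Laplacian `3`, apart from corrections at the three corners that let the flux
`φ i` enter at the corner `i`; the constant `c` is the value at the centre of the equivalent
star. -/
noncomputable def potential : (n : ℕ) → ℝ → (Fin 3 → ℝ) → State n → ℝ
  | 0, c, _, _ => c
  | n + 1, c, φ, s =>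
    -- The term with `φ` is the potential of the centre of this copy's star relative to the common
    -- centre; the term before it offsets the `-2 * 3 ^ n` in the flux at the outer corner.
    potential n (c + 2 * 3 ^ n * starResistance n +
        φ (s (Fin.last n)) * (2 * starResistance n + 1) / 3)
      -- The three copies form a triangle with equal sides, so the edge between copies `p` and `r`
      -- carries the current `(φ p - φ r) / 3`; this is subtracted at the inner corner.
      (fun q => if q = s (Fin.last n) then φ q - 2 * 3 ^ n
        else 3 ^ n - (φ (s (Fin.last n)) - φ (-(s (Fin.last n) + q))) / 3)
      (Fin.init s)

theorem potential_snoc (n : ℕ) (c : ℝ) (φ : Fin 3 → ℝ) (s : State n) (p : Fin 3) :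
    potential (n + 1) c φ (Fin.snoc s p) =
      potential n (c + 2 * 3 ^ n * starResistance n + φ p * (2 * starResistance n + 1) / 3)
        (fun q => if q = p then φ q - 2 * 3 ^ n else 3 ^ n - (φ p - φ (-(p + q))) / 3) s := by
  simp [potential]

theorem sum_inner_flux (a : ℝ) {φ : Fin 3 → ℝ} (hφ : ∑ i, φ i = 0) (p : Fin 3) :
    ∑ q, (if q = p then φ q - 2 * a else a - (φ p - φ (-(p + q))) / 3) = 0 := by
  rw [Fin.sum_univ_three] at hφ ⊢
  have h01 : -(0 + 1 : Fin 3) = 2 := by decide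
  have h02 : -(0 + 2 : Fin 3) = 1 := by decide
  have h12 : -(1 + 2 : Fin 3) = 0 := by decide
  have h10 : -(1 + 0 : Fin 3) = 2 := by decide
  have h20 : -(2 + 0 : Fin 3) = 1 := by decide
  have h21 : -(2 + 1 : Fin 3) = 0 := by decide
  fin_cases p <;>
    simp only [Fin.zero_eta, Fin.mk_one, Fin.reduceFinMk, h01, h02, h10, h12, h20, h21] <;>
    simp <;> linarith

/-- Star-triangle transformation: two inner arms and a joining edge make a triangle side `2R + 1`,
which becomes an arm `(2R + 1) / 3` in series with the outer arm `R`. -/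
theorem starResistance_succ (n : ℕ) :
    starResistance (n + 1) = starResistance n + (2 * starResistance n + 1) / 3 := by
  unfold starResistance
  ring

theorem allOn_succ (n : ℕ) (i : Fin 3) : allOn (n + 1) i = Fin.snoc (allOn n i) i :=
  ((snoc_eq_allOn_iff _ _ _).2 ⟨rfl, rfl⟩).symm

theorem potential_allOn (n : ℕ) (c : ℝ) {φ : Fin 3 → ℝ} (hφ : ∑ i, φ i = 0) (i : Fin 3) :
    potential n c φ (allOn n i) = c + starResistance n * φ i := by
  induction n generalizing c φ with
  | zero => simp [potential, starResistance]
  | succ n ih =>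
    rw [allOn_succ, potential_snoc, ih _ (sum_inner_flux _ hφ i), starResistance_succ, if_pos rfl]
    ring

/-- By `potential_allOn`, the jump across a joining edge is the current prescribed for it, so it
restores Laplacian `3` at inner corners. For `n = 0` all corners coincide and both sides vanish
because the fluxes sum to `0`. -/
theorem laplacian_potential (n : ℕ) (c : ℝ) {φ : Fin 3 → ℝ} (hφ : ∑ i, φ i = 0) (s : State n) :
    laplacian (potential n c φ) s = 3 - ∑ i, if s = allOn n i then 3 ^ n - φ i else 0 := by
  induction n generalizing c φ with
  | zero =>
    have h1 : ∀ i (x : ℝ), (if s = allOn 0 i then x else 0) = x := fun i _ =>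
      if_pos (Subsingleton.elim _ _)
    simp [laplacian, potential, h1, hφ]
  | succ n ih =>
    rw [← Fin.snoc_init_self s]
    generalize Fin.init s = s', s (Fin.last n) = p
    have hjump : ∀ q, (if q ≠ p ∧ s' = allOn n q then
        potential (n + 1) c φ (Fin.snoc s' p) - potential (n + 1) c φ (Fin.snoc s' (-(p + q)))
          else 0) = if q ≠ p ∧ s' = allOn n q then (φ p - φ (-(p + q))) / 3 else 0 := by
      intro q
      refine if_ctx_congr Iff.rfl (fun h => ?_) fun _ => rfl
      obtain ⟨hq, rfl⟩ := h
      have hq' : q ≠ -(p + q) := by revert p q; decide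
      have hqq : -(-(p + q) + q) = p := by abel
      rw [potential_snoc, potential_snoc, potential_allOn _ _ (sum_inner_flux _ hφ _),
        potential_allOn _ _ (sum_inner_flux _ hφ _), if_neg hq, if_neg hq', hqq]
      ring
    rw [laplacian_snoc, Finset.sum_congr rfl fun q _ => hjump q]
    simp only [potential_snoc]
    rw [ih _ (sum_inner_flux _ hφ p)]
    have hsum : ∀ q, (if s' = allOn n q then 3 ^ n -
          (if q = p then φ q - 2 * 3 ^ n else 3 ^ n - (φ p - φ (-(p + q))) / 3) else 0) =
        (if q ≠ p ∧ s' = allOn n q then (φ p - φ (-(p + q))) / 3 else 0) +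
          if (Fin.snoc s' p : State (n + 1)) = allOn (n + 1) q then 3 ^ (n + 1) - φ q else 0 := by
      intro q
      simp only [snoc_eq_allOn_iff]
      by_cases hs : s' = allOn n q
      · by_cases hq : q = p
        · subst hq
          simp [hs]
          ring
        · simp [hs, hq, Ne.symm hq]
      · simp [hs]
    rw [Finset.sum_congr rfl fun q _ => hsum q, Finset.sum_add_distrib]
    ring

/-- The fluxes enter the centres of the three copies linearly and cancel in the sum. -/
theorem sum_potential (n : ℕ) (c : ℝ) {φ : Fin 3 → ℝ} (hφ : ∑ i, φ i = 0) :
    ∑ s, potential n c φ s = 3 ^ n * (c + ((5 ^ n - 1) / 4 - (3 ^ n - 1) / 2)) := by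
  induction n generalizing c φ with
  | zero => simp [potential]
  | succ n ih =>
    rw [sum_state_succ]
    simp only [potential_snoc]
    rw [Finset.sum_congr rfl fun p _ => ih _ (sum_inner_flux _ hφ p), ← Finset.mul_sum,
      Fin.sum_univ_three]
    rw [Fin.sum_univ_three] at hφ
    have h2 : φ 2 = -φ 0 - φ 1 := by linarith
    have h3 : (3 : ℝ) ^ n * starResistance n = (5 ^ n - 3 ^ n) / 2 := by
      rw [starResistance, div_pow]
      field_simp
    rw [h2]
    linear_combination (2 * 3 ^ (n + 1)) * h3
-- From the Laplacian to expected numbers of moves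
theorem sum_stepPMF {n : ℕ} {s : State n} (h : ((graph n).neighborFinset s).Nonempty)
    (f : State n → ℝ) : ∑ t, (stepPMF s t).toReal * f t =
      (∑ t ∈ (graph n).neighborFinset s, f t) / ((graph n).neighborFinset s).card := by
  rw [Finset.sum_div, ← Finset.sum_subset (Finset.subset_univ ((graph n).neighborFinset s))]
  · refine Finset.sum_congr rfl fun t ht => ?_
    rw [stepPMF, dif_pos h, PMF.uniformOfFinset_apply_of_mem h ht]
    simp [div_eq_inv_mul]
  · intro t _ ht
    rw [stepPMF, dif_pos h, PMF.uniformOfFinset_apply_of_notMem h ht]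
    simp

theorem first_step_of_laplacian {n : ℕ} {s : State n} {f : State n → ℝ} {p : Fin 3}
    (hs : s ≠ allOn n p) (hf : laplacian f s = ((graph n).neighborFinset s).card) :
    f s = 1 + ∑ t, (stepPMF s t).toReal * f t := by
  have hne : ((graph n).neighborFinset s).Nonempty := by
    rw [← Finset.card_pos, Nat.pos_iff_ne_zero]
    intro h0
    have hd := degree_eq n s
    rw [h0] at hd
    -- Degree `0` would need `s` to be all three corners at once, which `hs` excludes.
    have hlt : ∑ i, (if s = allOn n i then (1 : ℝ) else 0) < ∑ _i : Fin 3, (1 : ℝ) :=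
      Finset.sum_lt_sum (fun i _ => by split_ifs <;> norm_num)
        ⟨p, Finset.mem_univ p, by simp [hs]⟩
    simp only [Nat.cast_zero, Finset.sum_const, Finset.card_univ, Fintype.card_fin, nsmul_eq_mul,
      mul_one, Nat.cast_ofNat] at hd hlt
    linarith
  have hpos : (0 : ℝ) < ((graph n).neighborFinset s).card := by exact_mod_cast hne.card_pos
  rw [sum_stepPMF hne]
  rw [laplacian, Finset.sum_sub_distrib, Finset.sum_const, nsmul_eq_mul] at hf
  field_simp
  linarith

/-- The potential solves the first step equations at a state as soon as the flux is `3 ^ n - 1`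
at the corner where this state lies. -/
theorem potential_first_step {n : ℕ} {c : ℝ} {φ : Fin 3 → ℝ} (hφ : ∑ i, φ i = 0) {s : State n}
    {p : Fin 3} (hs : s ≠ allOn n p) (h : ∀ i, s = allOn n i → φ i = 3 ^ n - 1) :
    potential n c φ s = 1 + ∑ t, (stepPMF s t).toReal * potential n c φ t := by
  refine first_step_of_laplacian hs ?_
  rw [laplacian_potential n c hφ, degree_eq]
  congr 1
  refine Finset.sum_congr rfl fun i _ => ?_
  split_ifs with hi
  · rw [h i hi]
    ring
  · rfl

/-- The fluxes when the walk is stopped at the corner `p`. -/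
def cornerFlux (n : ℕ) (p i : Fin 3) : ℝ := if i = p then -2 * (3 ^ n - 1) else 3 ^ n - 1

theorem sum_cornerFlux (n : ℕ) (p : Fin 3) : ∑ i, cornerFlux n p i = 0 := by
  rw [Fin.sum_univ_three]
  fin_cases p <;> simp [cornerFlux] <;> ring

/-- The expected number of moves to the corner `p`, as a function of the starting state. -/
noncomputable def cornerTime (n : ℕ) (p : Fin 3) : State n → ℝ :=
  -- The constant cancels `starResistance n * cornerFlux n p p`, making the value at the target `0`.
  potential n (2 * starResistance n * (3 ^ n - 1)) (cornerFlux n p)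

theorem cornerTime_eq_zero (n : ℕ) (p : Fin 3) : ∀ s ∈ ({allOn n p} : Set (State n)),
    cornerTime n p s = 0 := by
  rintro s rfl
  rw [cornerTime, potential_allOn _ _ (sum_cornerFlux n p), cornerFlux, if_pos rfl]
  ring

theorem cornerTime_first_step (n : ℕ) (p : Fin 3) : ∀ s ∉ ({allOn n p} : Set (State n)),
    cornerTime n p s = 1 + ∑ t, (stepPMF s t).toReal * cornerTime n p t := by
  intro s hs
  refine potential_first_step (sum_cornerFlux n p) hs fun i hi => if_neg ?_
  rintro rfl
  exact hs hi

theorem meetingTime_eq_zero (n : ℕ) : ∀ s ∈ Set.range (allOn n), potential n 0 0 s = 0 := by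
  rintro s ⟨i, rfl⟩
  rw [potential_allOn _ _ (by simp)]
  simp

theorem meetingTime_first_step (n : ℕ) : ∀ s ∉ Set.range (allOn n),
    potential n 0 0 s = 1 + ∑ t, (stepPMF s t).toReal * potential n 0 0 t := fun _ hs =>
  potential_first_step (p := 0) (by simp) (fun h => hs ⟨0, h.symm⟩) fun i hi =>
    (hs ⟨i, hi.symm⟩).elim

theorem expectedMoves_uniform {n : ℕ} {A : Set (State n)} {g : State n → ℝ}
    (hA : ∀ s ∈ A, g s = 0) (hg : ∀ s ∉ A, g s = 1 + ∑ t, (stepPMF s t).toReal * g t) :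
    expectedMoves (PMF.uniformOfFintype (State n)) A = ENNReal.ofReal ((∑ s, g s) / 3 ^ n) := by
  rw [expectedMoves_eq _ hA hg, div_eq_inv_mul, ENNReal.ofReal_mul (by positivity),
    ENNReal.ofReal_sum_of_nonneg fun s _ => nonneg_of_first_step hA hg s, Finset.mul_sum]
  refine Finset.sum_congr rfl fun s _ => ?_
  rw [PMF.uniformOfFintype_apply, ENNReal.ofReal_inv_of_pos (by positivity)]
  simp [ENNReal.ofReal_pow]

/-! ### The three expectations -/

theorem ErandomToFirst_eq (n : ℕ) : ErandomToFirst n = ENNReal.ofReal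
    (2 * starResistance n * (3 ^ n - 1) + ((5 ^ n - 1) / 4 - (3 ^ n - 1) / 2)) := by
  rw [ErandomToFirst, expectedMoves_uniform (cornerTime_eq_zero n 0) (cornerTime_first_step n 0)]
  congr 1
  rw [div_eq_iff (by positivity), mul_comm]
  exact sum_potential n _ (sum_cornerFlux n 0)

theorem ErandomToAny_eq (n : ℕ) :
    ErandomToAny n = ENNReal.ofReal ((5 ^ n - 1) / 4 - (3 ^ n - 1) / 2) := by
  rw [ErandomToAny, expectedMoves_uniform (meetingTime_eq_zero n) (meetingTime_first_step n),
    sum_potential n 0 (by simp), zero_add, mul_div_cancel_left₀ _ (by positivity)]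

theorem EfirstToThird_eq (n : ℕ) :
    EfirstToThird n = ENNReal.ofReal (3 * starResistance n * (3 ^ n - 1)) := by
  rw [EfirstToThird, expectedMoves_eq _ (cornerTime_eq_zero n 2) (cornerTime_first_step n 2),
    Finset.sum_eq_single (allOn n 0)]
  · rw [PMF.pure_apply, if_pos rfl, one_mul, cornerTime, potential_allOn _ _ (sum_cornerFlux n 2),
      cornerFlux, if_neg (by decide)]
    congr 1
    ring
  · intro s _ hs
    rw [PMF.pure_apply, if_neg hs, zero_mul]
  · simp

theorem starResistance_nonneg (n : ℕ) : 0 ≤ starResistance n := by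
  have : (1 : ℝ) ≤ (5 / 3) ^ n := one_le_pow₀ (by norm_num)
  unfold starResistance
  linarith

/-- It is a mean of expected hitting times. The sign matters because `ENNReal.ofReal` truncates at
`0` and is additive only on nonnegative reals. -/
theorem meetingTime_mean_nonneg (n : ℕ) : (0 : ℝ) ≤ (5 ^ n - 1) / 4 - (3 ^ n - 1) / 2 := by
  rw [← zero_add (_ - _), ← mul_div_cancel_left₀ (0 + _) (pow_ne_zero n (three_ne_zero' ℝ)),
    ← sum_potential n 0 (φ := 0) (by simp)]
  exact div_nonneg (Finset.sum_nonneg fun s _ =>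
    nonneg_of_first_step (meetingTime_eq_zero n) (meetingTime_first_step n) s) (by positivity)

theorem two_mul_starResistance_mul_nonneg (n : ℕ) :
    (0 : ℝ) ≤ 2 * starResistance n * (3 ^ n - 1) :=
  mul_nonneg (mul_nonneg zero_le_two (starResistance_nonneg n))
    (sub_nonneg.2 (one_le_pow₀ (by norm_num)))

end Hanoi

theorem mainTheorem4 (n : ℕ) :
    Hanoi.ErandomToFirst n ≠ ∞ ∧
    (Hanoi.ErandomToFirst n).toReal =
      ((5 : ℝ) ^ (n + 1) - 2 * 3 ^ (n + 1) + 5) / 4 - (5 / 3 : ℝ) ^ n ∧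
    (Hanoi.ErandomToFirst n).toReal =
      (((3 : ℝ) ^ n - 1) * (5 ^ (n + 1) - 2 * 3 ^ (n + 1)) + 5 ^ n - 3 ^ n) / (4 * 3 ^ n) ∧
    Hanoi.ErandomToFirst n = Hanoi.ErandomToAny n + 2 / 3 * Hanoi.EfirstToThird n := by
  have h1 := Hanoi.two_mul_starResistance_mul_nonneg n
  have h2 := Hanoi.meetingTime_mean_nonneg n
  rw [Hanoi.EfirstToThird_eq, Hanoi.ErandomToAny_eq, Hanoi.ErandomToFirst_eq,
    ENNReal.toReal_ofReal (add_nonneg h1 h2)]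
  refine ⟨ENNReal.ofReal_ne_top, ?_, ?_, ?_⟩
  · rw [Hanoi.starResistance, div_pow]
    field_simp
    ring
  · rw [Hanoi.starResistance, div_pow]
    field_simp
    ring
  · have h3 : (2 / 3 : ℝ≥0∞) = ENNReal.ofReal (2 / 3) := by
      rw [ENNReal.ofReal_div_of_pos (by norm_num)]
      simp
    rw [h3, ← ENNReal.ofReal_mul (by norm_num), add_comm, ENNReal.ofReal_add h2 h1]
    congr 2
    ring
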